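/- Let $\mathbb{K}$ be $\mathbb{R}$ or $\mathbb{C}$, let $Y$ be a Banach space over $\mathbb{K}$, let $(\Omega,\Sigma,\mu)$ be a $\sigma$-finite measure space such that the space $L_1(\mu)$ of $\mathbb{K}$-valued integrable functions satisfies $\dim L_1(\mu)\ge 2$, and let $m\in\mathbb{N}$, $m\ge 2$. Write $\ell_1^m$ for $\mathbb{K}^m$ with the $\ell_1$-norm and $\ell_1$ for the space of absolutely summable sequences in $\mathbb{K}$. For Banach spaces $X,Y$ over $\mathbb{K}$, with $B_X$ and $S_X$ the closed unit ball and the unit sphere of $X$, a bounded linear operator $T\colon X\to Y$ is called range strongly exposing if there is $x_0\in S_X$ such that every sequence $(x_n)\subseteq B_X$ with $\|Tx_n\|\to\|T\|$ has a subsequence $(x_{\sigma(n)})$ with $Tx_{\sigma(n)}\to\lambda Tx_0$ for some $\lambda\in\mathbb{K}$, $|\lambda|=1$. The pair $(X,Y)$ has the BPBp-RSE (the Bishop--Phelps--Bollobás property for range strongly exposing operators) if for every $\varepsilon>0$ there is $0<\eta(\varepsilon)<\varepsilon$ such that for every bounded linear $T\colon X\to Y$ with $\|T\|=1$ and every $x\in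 S_X$ with $\|Tx\|>1-\eta(\varepsilon)$ there are a range strongly exposing operator $S\colon X\to Y$ and a point $x_0\in S_X$ with $$\|S\|=\|Sx_0\|=1,\qquad \|S-T\|<\varepsilon,\qquad \|x-x_0\|<\varepsilon.$$ The space $Y$ is uniformly convex if for every $\varepsilon>0$ there is $0<\delta<1$ such that $\|y_1-y_2\|<\varepsilon$ whenever $y_1,y_2\in S_Y$ and $\frac{\|y_1+y_2\|}{2}>1-\delta$. Then the following are equivalent: (i) the pair $(\ell_1^m,Y)$ has the BPBp-RSE; (ii) the pair $(\ell_1,Y)$ has the BPBp-RSE; (iii) the pair $(L_1(\mu),Y)$ has the BPBp-RSE; (iv) $Y$ is uniformly convex. -/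

import Mathlib

open Filter Topology MeasureTheory
open scoped ENNReal

/-- A bounded operator `T : X → Y` is *range strongly exposing* if there is `x₀` in the unit sphere
of `X` such that every sequence `(xₙ)` in the closed unit ball of `X` with `‖T xₙ‖ → ‖T‖` has a
subsequence whose image under `T` converges to `c • T x₀` for some scalar `c` of modulus one. -/
def IsRangeStronglyExposing {𝕜 X Y : Type*} [RCLike 𝕜]
    [NormedAddCommGroup X] [NormedSpace 𝕜 X] [NormedAddCommGroup Y] [NormedSpace 𝕜 Y]
    (T : X →L[𝕜] Y) : Prop :=
  ∃ x₀ : X, ‖x₀‖ = 1 ∧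
    ∀ x : ℕ → X, (∀ n, ‖x n‖ ≤ 1) →
      Tendsto (fun n => ‖T (x n)‖) atTop (𝓝 ‖T‖) →
      ∃ σ : ℕ → ℕ, StrictMono σ ∧
        ∃ c : 𝕜, ‖c‖ = 1 ∧ Tendsto (fun n => T (x (σ n))) atTop (𝓝 (c • T x₀))

/-- The pair `(X, Y)` has the *Bishop-Phelps-Bollobás property for range strongly exposing
operators* (BPBp-RSE), over the scalar field `𝕜`. -/
def HasBPBpRSE (𝕜 X Y : Type*) [RCLike 𝕜]
    [NormedAddCommGroup X] [NormedSpace 𝕜 X] [NormedAddCommGroup Y] [NormedSpace 𝕜 Y] : Prop :=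
  ∀ ε : ℝ, 0 < ε → ∃ η : ℝ, 0 < η ∧ η < ε ∧
    ∀ (T : X →L[𝕜] Y) (x : X), ‖T‖ = 1 → ‖x‖ = 1 → 1 - η < ‖T x‖ →
      ∃ (S : X →L[𝕜] Y) (x₀ : X), IsRangeStronglyExposing S ∧ ‖x₀‖ = 1 ∧
        ‖S‖ = 1 ∧ ‖S x₀‖ = 1 ∧ ‖S - T‖ < ε ∧ ‖x - x₀‖ < ε

/-! All three domains are $L_1$ spaces, the sequence spaces being $L_1$ of a counting measure, so
two implications suffice.

Necessity: a nontrivial L-projection splits the domain into an $\ell_1$-sum. If $y,z\in S_Y$ and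
$\|y+z\|$ is nearly $2$, an operator $T$ of norm one sending unit vectors $e_1,e_2$ of the two
summands to $y,z$ almost attains its norm at $(e_1+e_2)/2$. The approximating $S$ attains its norm
at a nearby $x_0=p+q$, hence on both components $p$ and $q$, whose norms are close to $1/2$. Range
strong exposure puts $Sp$ and $Sq$ on one line, and $\|Sp+Sq\|=1$ aligns their phases; so $Sp\approx
Sq$, hence $y\approx z$ (`HasBPBpRSE.uniformConvexSpace`).

Sufficiency: let $\psi$ norm $Tf$ and $y_0=Tf/\|Tf\|$. A Hahn decomposition gives a set $A$ carrying
most of the mass of $f$ such that for every $E\subseteq A$ the normalized image of $\mathbb 1_E f$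
lies in a thin slice of $B_Y$ cut by $\psi$ (`exists_measurableSet_forall_le_re`). Uniform convexity
makes that slice small, so on functions supported in $A$ the operator $T$ is close to the rank-one
operator $\Lambda\otimes y_0$, with $\Lambda$ integration against the conjugate sign of $f$. Take
$S=\Lambda\otimes y_0$ on $A$ and $S=(1-r)T$ off $A$: the gap $r$ drives maximizing sequences into
$A$, where the range of $S$ is a line (`IsRangeStronglyExposing.of_smulRight_add`). -/

section Abstract

/-! ### Range strongly exposing operators and L-projections on general normed spaces. -/

variable {𝕜 X X' Y : Type*} [RCLike 𝕜]
  [NormedAddCommGroup X] [NormedSpace 𝕜 X] [NormedAddCommGroup X'] [NormedSpace 𝕜 X']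
  [NormedAddCommGroup Y] [NormedSpace 𝕜 Y]

/-- A rank-one operator that attains its norm, perturbed by an operator which is strictly smaller
on an `ℓ₁`-complement, is range strongly exposing. -/
theorem IsRangeStronglyExposing.of_smulRight_add {Λ : X →L[𝕜] 𝕜} {R : X →L[𝕜] Y} {q : X → ℝ}
    {y₀ : Y} {x₀ : X} {r : ℝ} (hr : 0 < r) (hy₀ : ‖y₀‖ = 1) (hx₀ : ‖x₀‖ = 1) (hΛ : Λ x₀ = 1)
    (hq : ∀ x, 0 ≤ q x) (hΛq : ∀ x, ‖Λ x‖ + q x ≤ ‖x‖) (hR : ∀ x, ‖R x‖ ≤ (1 - r) * q x) :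
    IsRangeStronglyExposing (Λ.smulRight y₀ + R) ∧ ‖Λ.smulRight y₀ + R‖ = 1 ∧
      (Λ.smulRight y₀ + R) x₀ = y₀ := by
  have hqx : q x₀ = 0 := by
    have := hΛq x₀
    rw [hΛ, norm_one, hx₀] at this
    linarith [hq x₀]
  have hRx : R x₀ = 0 := by
    have := hR x₀
    rw [hqx, mul_zero] at this
    exact norm_le_zero_iff.1 this
  have hS : (Λ.smulRight y₀ + R) x₀ = y₀ := by simp [hΛ, hRx]
  have hle : ∀ x, ‖(Λ.smulRight y₀ + R) x‖ ≤ ‖Λ x‖ + (1 - r) * q x := fun x => by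
    refine (norm_add_le _ _).trans (add_le_add ?_ (hR x))
    simp [norm_smul, hy₀]
  have hnorm : ‖Λ.smulRight y₀ + R‖ = 1 := by
    refine le_antisymm (ContinuousLinearMap.opNorm_le_bound _ zero_le_one fun x => ?_) ?_
    · nlinarith [hle x, hΛq x, hq x]
    · have := (Λ.smulRight y₀ + R).le_opNorm x₀
      rwa [hS, hy₀, hx₀, mul_one] at this
  refine ⟨⟨x₀, hx₀, fun x hx hlim => ?_⟩, hnorm, hS⟩
  rw [hnorm] at hlim
  set S := Λ.smulRight y₀ + R with hSdef
  -- On the unit ball $\|Sx\|\le\|\Lambda x\|+(1-r)q(x)\le 1-r\,q(x)$, so a maximizing sequence has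
  -- $q\to0$.
  have hq0 : Tendsto (fun n => q (x n)) atTop (𝓝 0) := by
    have h1 : Tendsto (fun n => r⁻¹ * (1 - ‖S (x n)‖)) atTop (𝓝 0) := by
      simpa using ((tendsto_const_nhds (x := (1 : ℝ))).sub hlim).const_mul r⁻¹
    refine squeeze_zero (fun n => hq _) (fun n => ?_) h1
    rw [le_inv_mul_iff₀ hr]
    nlinarith [hle (x n), hΛq (x n), hx n]
  have hR0 : Tendsto (fun n => R (x n)) atTop (𝓝 0) := by
    refine squeeze_zero_norm (fun n => hR (x n)) ?_
    simpa using hq0.const_mul (1 - r)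
  have hΛ1 : Tendsto (fun n => ‖Λ (x n)‖) atTop (𝓝 1) := by
    have h1 : Tendsto (fun n => ‖S (x n)‖ - (1 - r) * q (x n)) atTop (𝓝 1) := by
      simpa using hlim.sub (hq0.const_mul (1 - r))
    refine tendsto_of_tendsto_of_tendsto_of_le_of_le h1 tendsto_const_nhds (fun n => ?_)
      (fun n => ?_)
    · have := hle (x n)
      simp only [tsub_le_iff_right]
      exact this
    · have := hΛq (x n)
      have := hq (x n)
      have := hx n
      simp only
      linarith
  have hball : ∀ n, Λ (x n) ∈ Metric.closedBall (0 : 𝕜) 1 := fun n => by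
    rw [mem_closedBall_zero_iff]
    linarith [hΛq (x n), hq (x n), hx n]
  -- Only scalars need compactness: $R(x_n)\to0$ leaves just the coefficient of $y_0$.
  obtain ⟨c, -, σ, hσ, hc⟩ := (isCompact_closedBall (0 : 𝕜) 1).tendsto_subseq hball
  refine ⟨σ, hσ, c, tendsto_nhds_unique hc.norm (hΛ1.comp hσ.tendsto_atTop), ?_⟩
  rw [hS]
  have := (hc.smul_const y₀).add (hR0.comp hσ.tendsto_atTop)
  simpa [hSdef] using this

/-- The values of a range strongly exposing operator at its norm-attaining vectors are, up to
positive multiples, unimodular multiples of a single vector. -/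
theorem IsRangeStronglyExposing.exists_forall_eq_smul {S : X →L[𝕜] Y}
    (hS : IsRangeStronglyExposing S) :
    ∃ w : Y, ∀ p : X, p ≠ 0 → ‖S p‖ = ‖S‖ * ‖p‖ →
      ∃ c : 𝕜, ‖c‖ = 1 ∧ S p = ((‖p‖ : 𝕜) * c) • w := by
  obtain ⟨x₀, -, h⟩ := hS
  refine ⟨S x₀, fun p hp hSp => ?_⟩
  have hp' : ‖p‖ ≠ 0 := norm_ne_zero_iff.2 hp
  have hn : ‖((‖p‖ : 𝕜)⁻¹ • p)‖ = 1 := by simp [norm_smul, hp']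
  -- The constant sequence $p/\|p\|$ is maximizing, so the limit is its own image.
  obtain ⟨σ, -, c, hc, hlim⟩ := h (fun _ => (‖p‖ : 𝕜)⁻¹ • p) (fun _ => hn.le) (by
    have : ‖S ((‖p‖ : 𝕜)⁻¹ • p)‖ = ‖S‖ := by
      rw [map_smul, norm_smul, hSp]
      simp
      field_simp
    rw [this]
    exact tendsto_const_nhds)
  have := tendsto_nhds_unique hlim tendsto_const_nhds
  refine ⟨c, hc, ?_⟩
  rw [mul_smul, this, map_smul, smul_smul, mul_inv_cancel₀ (by simpa using hp), one_smul]

/-- Strict convexity of the scalar field: equality in the triangle inequality puts both terms on one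
real ray. -/
theorem RCLike.eq_of_norm_eq_one_of_norm_add {a b : ℝ} {c d : 𝕜} (ha : 0 < a) (hb : 0 < b)
    (hc : ‖c‖ = 1) (hd : ‖d‖ = 1) (h : ‖(a : 𝕜) * c + (b : 𝕜) * d‖ = a + b) : c = d := by
  have h1 : ‖(a : 𝕜) * c‖ = a := by simp [hc, abs_of_pos ha]
  have h2 : ‖(b : 𝕜) * d‖ = b := by simp [hd, abs_of_pos hb]
  have h3 : SameRay ℝ ((a : 𝕜) * c) ((b : 𝕜) * d) := by
    rw [sameRay_iff_norm_add, h, h1, h2]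
  have h4 := h3.norm_smul_eq
  rw [h1, h2, RCLike.real_smul_eq_coe_mul, RCLike.real_smul_eq_coe_mul] at h4
  have ha' : (a : 𝕜) ≠ 0 := by exact_mod_cast ha.ne'
  have hb' : (b : 𝕜) ≠ 0 := by exact_mod_cast hb.ne'
  have h5 : ((a : 𝕜) * b) * d = (a * b) * c := by linear_combination h4
  exact (mul_left_cancel₀ (mul_ne_zero ha' hb') h5).symm

/-- If `X` has a nontrivial `L`-projection and `(X, Y)` has the BPBp-RSE, then `Y` is uniformly
convex. -/
theorem HasBPBpRSE.uniformConvexSpace (P : X →L[𝕜] X)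
    (hP : ∀ x, ‖x‖ = ‖P x‖ + ‖x - P x‖) {u v : X} (hu : u ≠ 0) (hv : v ≠ 0)
    (hPu : P u = u) (hPv : P v = 0) (h : HasBPBpRSE 𝕜 X Y) : UniformConvexSpace Y := by
  obtain ⟨e₁, he₁, hPe₁⟩ : ∃ e : X, ‖e‖ = 1 ∧ P e = e :=
    ⟨(‖u‖ : 𝕜)⁻¹ • u, by simp [norm_smul, norm_ne_zero_iff.2 hu], by rw [map_smul, hPu]⟩
  obtain ⟨e₂, he₂, hPe₂⟩ : ∃ e : X, ‖e‖ = 1 ∧ P e = 0 :=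
    ⟨(‖v‖ : 𝕜)⁻¹ • v, by simp [norm_smul, norm_ne_zero_iff.2 hv], by rw [map_smul, hPv, smul_zero]⟩
  obtain ⟨f, hf, hfe⟩ := exists_dual_vector 𝕜 e₁ (by simp [he₁])
  obtain ⟨g, hg, hge⟩ := exists_dual_vector 𝕜 e₂ (by simp [he₂])
  rw [he₁, RCLike.ofReal_one] at hfe
  rw [he₂, RCLike.ofReal_one] at hge
  refine ⟨fun ε hε => ?_⟩
  -- The final estimate is $\|y-z\|\le 12\varepsilon'<\varepsilon$; the bound $1/8$ keeps both
  -- components of $x_0$ nonzero.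
  set ε' : ℝ := min (ε / 16) (1 / 8)
  have hε'0 : 0 < ε' := by positivity
  have hε'1 : ε' ≤ ε / 16 := min_le_left _ _
  have hε'2 : ε' ≤ 1 / 8 := min_le_right _ _
  obtain ⟨η, hη, -, H⟩ := h ε' hε'0
  refine ⟨2 * η, by positivity, fun y hy z hz hyz => ?_⟩
  by_contra! hlt
  let T : X →L[𝕜] Y := (f ∘L P).smulRight y + (g ∘L (ContinuousLinearMap.id 𝕜 X - P)).smulRight z
  have hT : ∀ x, T x = f (P x) • y + g (x - P x) • z := fun x => rfl
  have hTe₁ : T e₁ = y := by simp [hT, hPe₁, hfe]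
  have hTe₂ : T e₂ = z := by simp [hT, hPe₂, hge]
  have hTle : ∀ x, ‖T x‖ ≤ ‖x‖ := fun x => by
    rw [hT, hP x]
    refine (norm_add_le _ _).trans ?_
    rw [norm_smul, norm_smul, hy, hz, mul_one, mul_one]
    have h1 := f.le_opNorm (P x)
    have h2 := g.le_opNorm (x - P x)
    rw [hf] at h1
    rw [hg] at h2
    linarith
  have hTn : ‖T‖ = 1 := by
    refine le_antisymm (T.opNorm_le_bound zero_le_one fun x => by simpa using hTle x) ?_
    simpa [hTe₁, hy, he₁] using T.le_opNorm e₁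
  have h2n : ‖(2 : 𝕜)⁻¹‖ = 1 / 2 := by simp
  set x : X := (2 : 𝕜)⁻¹ • (e₁ + e₂) with hx
  have hPx : P x = (2 : 𝕜)⁻¹ • e₁ := by simp [hx, hPe₁, hPe₂]
  have hQx : x - P x = (2 : 𝕜)⁻¹ • e₂ := by rw [hPx, hx, smul_add, add_sub_cancel_left]
  have hxn : ‖x‖ = 1 := by
    rw [hP x, hQx, hPx, norm_smul, norm_smul, he₁, he₂, h2n]; norm_num
  obtain ⟨S, x₀, hS, hx₀, hSn, hSx₀, hST, hxx₀⟩ := H T x hTn hxn (by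
    have : T x = (2 : 𝕜)⁻¹ • (y + z) := by rw [hx, map_smul, map_add, hTe₁, hTe₂]
    rw [this, norm_smul, h2n]
    linarith)
  obtain ⟨w, hw⟩ := hS.exists_forall_eq_smul
  set p := P x₀ with hp
  set q := x₀ - P x₀ with hq
  have hpq : ‖p‖ + ‖q‖ = 1 := by rw [← hP x₀, hx₀]
  have hd : ‖(2 : 𝕜)⁻¹ • e₁ - p‖ + ‖(2 : 𝕜)⁻¹ • e₂ - q‖ < ε' := by
    have := hP (x - x₀)
    rw [map_sub, hPx, ← hp] at this
    have h3 : x - x₀ - ((2 : 𝕜)⁻¹ • e₁ - p) = (2 : 𝕜)⁻¹ • e₂ - q := by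
      rw [← hQx, ← hPx, hq]; abel
    rw [h3] at this
    rw [← this]; exact hxx₀
  have hd1 := norm_nonneg ((2 : 𝕜)⁻¹ • e₁ - p)
  have hd2 := norm_nonneg ((2 : 𝕜)⁻¹ • e₂ - q)
  have hpa : |1 / 2 - ‖p‖| ≤ ‖(2 : 𝕜)⁻¹ • e₁ - p‖ := by
    have := abs_norm_sub_norm_le ((2 : 𝕜)⁻¹ • e₁) p
    rwa [norm_smul, he₁, h2n, mul_one] at this
  have hqa : |1 / 2 - ‖q‖| ≤ ‖(2 : 𝕜)⁻¹ • e₂ - q‖ := by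
    have := abs_norm_sub_norm_le ((2 : 𝕜)⁻¹ • e₂) q
    rwa [norm_smul, he₂, h2n, mul_one] at this
  rw [abs_le] at hpa hqa
  have hp0 : 0 < ‖p‖ := by linarith [hpa.1, hpa.2]
  have hq0 : 0 < ‖q‖ := by linarith [hqa.1, hqa.2]
  have hSp' : ‖S p‖ ≤ ‖p‖ := by simpa [hSn] using S.le_opNorm p
  have hSq' : ‖S q‖ ≤ ‖q‖ := by simpa [hSn] using S.le_opNorm q
  have hsum : S x₀ = S p + S q := by rw [← map_add, hq, hp, add_sub_cancel]
  -- Since $\|Sp\|\le\|p\|$, $\|Sq\|\le\|q\|$ and $\|p\|+\|q\|=1$, both inequalities must be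
  -- equalities.
  have h1 : 1 ≤ ‖S p‖ + ‖S q‖ := by rw [← hSx₀, hsum]; exact norm_add_le _ _
  have hSp : ‖S p‖ = ‖p‖ := by linarith
  have hSq : ‖S q‖ = ‖q‖ := by linarith
  obtain ⟨c, hc, hcp⟩ := hw p (norm_pos_iff.1 hp0) (by rw [hSn, one_mul, hSp])
  obtain ⟨d, hd', hdq⟩ := hw q (norm_pos_iff.1 hq0) (by rw [hSn, one_mul, hSq])
  have hwn : ‖w‖ = 1 := by
    rw [hcp, norm_smul, norm_mul, hc, RCLike.norm_ofReal, abs_norm, mul_one] at hSp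
    exact mul_left_cancel₀ hp0.ne' (hSp.trans (mul_one _).symm)
  have hcd : c = d := by
    refine RCLike.eq_of_norm_eq_one_of_norm_add hp0 hq0 hc hd' ?_
    rw [hpq, ← hSx₀, hsum, hcp, hdq, ← add_smul, norm_smul, hwn, mul_one]
  have hdiff : ‖S p - S q‖ ≤ 2 * ε' := by
    rw [hcp, hdq, hcd, ← sub_smul, norm_smul, hwn, mul_one, ← sub_mul, norm_mul, hd', mul_one,
      ← RCLike.ofReal_sub, RCLike.norm_ofReal, abs_le]
    constructor <;> linarith [hpa.1, hpa.2, hqa.1, hqa.2]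
  have key : ∀ e s : X, ‖s‖ ≤ 1 → ‖(2 : 𝕜)⁻¹ • e - s‖ ≤ ε' →
      ‖(2 : 𝕜)⁻¹ • T e - S s‖ ≤ 2 * ε' := fun e s hs hes => by
    have : (2 : 𝕜)⁻¹ • T e - S s = T ((2 : 𝕜)⁻¹ • e - s) - (S - T) s := by
      simp
    rw [this]
    refine (norm_sub_le _ _).trans ?_
    have h3 := (S - T).le_opNorm s
    have h4 : ‖S - T‖ * ‖s‖ ≤ ‖S - T‖ * 1 := by gcongr
    linarith [hTle ((2 : 𝕜)⁻¹ • e - s)]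
  have k1 := key e₁ p (by linarith) (by linarith)
  have k2 := key e₂ q (by linarith) (by linarith)
  rw [hTe₁] at k1
  rw [hTe₂] at k2
  have h5 : (2 : 𝕜)⁻¹ • (y - z) =
      ((2 : 𝕜)⁻¹ • y - S p) - ((2 : 𝕜)⁻¹ • z - S q) + (S p - S q) := by
    rw [smul_sub]; abel
  have h6 : ‖(2 : 𝕜)⁻¹ • (y - z)‖ ≤ 6 * ε' := by
    rw [h5]
    refine (norm_add_le _ _).trans ?_
    linarith [norm_sub_le ((2 : 𝕜)⁻¹ • y - S p) ((2 : 𝕜)⁻¹ • z - S q)]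
  rw [norm_smul, h2n] at h6
  linarith

theorem IsRangeStronglyExposing.comp_linearIsometryEquiv {S : X →L[𝕜] Y}
    (hS : IsRangeStronglyExposing S) (e : X' ≃ₗᵢ[𝕜] X) :
    IsRangeStronglyExposing (S ∘L (e.toContinuousLinearEquiv : X' →L[𝕜] X)) := by
  obtain ⟨x₀, hx₀, h⟩ := hS
  refine ⟨e.symm x₀, by simpa using hx₀, fun x hx hlim => ?_⟩
  have hn : ‖S ∘L (e.toContinuousLinearEquiv : X' →L[𝕜] X)‖ = ‖S‖ :=
    S.opNorm_comp_linearIsometryEquiv e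
  rw [hn] at hlim
  obtain ⟨σ, hσ, c, hc, hlim'⟩ := h (fun n => e (x n)) (by simpa using hx) (by simpa using hlim)
  exact ⟨σ, hσ, c, hc, by simpa using hlim'⟩

theorem HasBPBpRSE.of_linearIsometryEquiv (e : X ≃ₗᵢ[𝕜] X') (h : HasBPBpRSE 𝕜 X Y) :
    HasBPBpRSE 𝕜 X' Y := by
  intro ε hε
  obtain ⟨η, hη, hηε, H⟩ := h ε hε
  refine ⟨η, hη, hηε, fun T x hT hx hTx => ?_⟩
  obtain ⟨S, x₀, hS, hx₀, hSn, hSx₀, hST, hxx₀⟩ :=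
    H (T ∘L (e.toContinuousLinearEquiv : X →L[𝕜] X')) (e.symm x)
      ((T.opNorm_comp_linearIsometryEquiv e).trans hT) (by simpa using hx) (by simpa using hTx)
  refine ⟨S ∘L (e.symm.toContinuousLinearEquiv : X' →L[𝕜] X), e x₀,
    hS.comp_linearIsometryEquiv e.symm, by simpa using hx₀,
    (S.opNorm_comp_linearIsometryEquiv e.symm).trans hSn, by simpa using hSx₀, ?_, ?_⟩
  · have : S ∘L (e.symm.toContinuousLinearEquiv : X' →L[𝕜] X) - T =
        (S - T ∘L (e.toContinuousLinearEquiv : X →L[𝕜] X')) ∘L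
          (e.symm.toContinuousLinearEquiv : X' →L[𝕜] X) := by
      ext; simp
    rw [this]
    exact ((S - _).opNorm_comp_linearIsometryEquiv e.symm).trans_lt hST
  · have : x - e x₀ = e (e.symm x - x₀) := by simp
    rwa [this, e.norm_map]

end Abstract

/-! ### Restriction to measurable sets in $L_1$, and sufficiency of uniform convexity. -/

section LOne

variable {𝕜 Ω Y : Type*} [RCLike 𝕜] [MeasurableSpace Ω] {μ : Measure Ω}
  [NormedAddCommGroup Y] [NormedSpace 𝕜 Y]

namespace MeasureTheory.L1

theorem integrable_mul_coeFn {g : Ω → 𝕜} (hg : Measurable g) (hb : ∀ x, ‖g x‖ ≤ 1)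
    (u : Lp 𝕜 1 μ) : Integrable (fun x => g x * u x) μ :=
  (L1.integrable_coeFn u).bdd_mul hg.aestronglyMeasurable (Eventually.of_forall hb)

/-- Multiplication by a measurable function bounded by one, as an operator on `L¹`. -/
noncomputable def mulCLM (μ : Measure Ω) (g : Ω → 𝕜) (hg : Measurable g) (hb : ∀ x, ‖g x‖ ≤ 1) :
    Lp 𝕜 1 μ →L[𝕜] Lp 𝕜 1 μ :=
  LinearMap.mkContinuous
    { toFun := fun u => (integrable_mul_coeFn hg hb u).toL1 _
      map_add' := fun u v => by
        rw [← Integrable.toL1_add, Integrable.toL1_eq_toL1_iff]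
        filter_upwards [Lp.coeFn_add u v] with x hx
        change g x * (u + v : Lp 𝕜 1 μ) x = g x * u x + g x * v x
        rw [hx, Pi.add_apply, mul_add]
      map_smul' := fun c u => by
        rw [RingHom.id_apply, ← Integrable.toL1_smul, Integrable.toL1_eq_toL1_iff]
        filter_upwards [Lp.coeFn_smul c u] with x hx
        change g x * (c • u : Lp 𝕜 1 μ) x = c * (g x * u x)
        rw [hx, Pi.smul_apply, smul_eq_mul, mul_left_comm] } 1 fun u => by
    simp only [LinearMap.coe_mk, AddHom.coe_mk]
    rw [L1.norm_of_fun_eq_integral_norm, one_mul, L1.norm_eq_integral_norm]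
    refine integral_mono (integrable_mul_coeFn hg hb u).norm (L1.integrable_coeFn u).norm
      fun x => ?_
    simp only [norm_mul]
    exact mul_le_of_le_one_left (norm_nonneg _) (hb x)

theorem coeFn_mulCLM {g : Ω → 𝕜} (hg : Measurable g) (hb : ∀ x, ‖g x‖ ≤ 1) (u : Lp 𝕜 1 μ) :
    mulCLM μ g hg hb u =ᵐ[μ] fun x => g x * u x :=
  (integrable_mul_coeFn hg hb u).coeFn_toL1

/-- Multiplication by the indicator of a measurable set, as an operator on `L¹`. -/
noncomputable def indicatorCLM (𝕜 : Type*) [RCLike 𝕜] (μ : Measure Ω) {A : Set Ω}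
    (hA : MeasurableSet A) : Lp 𝕜 1 μ →L[𝕜] Lp 𝕜 1 μ :=
  mulCLM μ (A.indicator 1) (measurable_one.indicator hA) fun x => by
    by_cases hx : x ∈ A <;> simp [hx]

variable {A B : Set Ω}

theorem coeFn_indicatorCLM (hA : MeasurableSet A) (u : Lp 𝕜 1 μ) :
    indicatorCLM 𝕜 μ hA u =ᵐ[μ] A.indicator u := by
  refine (coeFn_mulCLM _ _ u).trans (Eventually.of_forall fun x => ?_)
  by_cases hx : x ∈ A <;> simp [hx]

theorem norm_indicatorCLM (hA : MeasurableSet A) (u : Lp 𝕜 1 μ) :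
    ‖indicatorCLM 𝕜 μ hA u‖ = ∫ x in A, ‖u x‖ ∂μ := by
  rw [L1.norm_eq_integral_norm, ← integral_indicator hA]
  refine integral_congr_ae ?_
  filter_upwards [coeFn_indicatorCLM hA u] with x hx
  rw [hx, norm_indicator_eq_indicator_norm]

theorem indicatorCLM_indicatorCLM (hA : MeasurableSet A) (hB : MeasurableSet B) (u : Lp 𝕜 1 μ) :
    indicatorCLM 𝕜 μ hA (indicatorCLM 𝕜 μ hB u) = indicatorCLM 𝕜 μ (hA.inter hB) u := by
  refine Lp.ext ?_
  filter_upwards [coeFn_indicatorCLM hA (indicatorCLM 𝕜 μ hB u), coeFn_indicatorCLM hB u,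
    coeFn_indicatorCLM (hA.inter hB) u] with x h1 h2 h3
  classical
  rw [h1, h3, Set.indicator_apply, h2, Set.indicator_apply, Set.indicator_apply]
  by_cases hx : x ∈ A <;> simp [hx]

theorem indicatorCLM_congr (hA : MeasurableSet A) (hB : MeasurableSet B) (h : A = B)
    (u : Lp 𝕜 1 μ) : indicatorCLM 𝕜 μ hA u = indicatorCLM 𝕜 μ hB u := by
  subst h; rfl

theorem indicatorCLM_union (hA : MeasurableSet A) (hB : MeasurableSet B) (hAB : Disjoint A B)
    (u : Lp 𝕜 1 μ) :
    indicatorCLM 𝕜 μ (hA.union hB) u = indicatorCLM 𝕜 μ hA u + indicatorCLM 𝕜 μ hB u := by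
  refine Lp.ext ?_
  filter_upwards [coeFn_indicatorCLM hA u, coeFn_indicatorCLM hB u,
    coeFn_indicatorCLM (hA.union hB) u,
    Lp.coeFn_add (indicatorCLM 𝕜 μ hA u) (indicatorCLM 𝕜 μ hB u)] with x h1 h2 h3 h4
  rw [h3, h4, Pi.add_apply, h1, h2, Set.indicator_union_of_disjoint hAB]

theorem indicatorCLM_univ (u : Lp 𝕜 1 μ) : indicatorCLM 𝕜 μ MeasurableSet.univ u = u := by
  refine Lp.ext ?_
  filter_upwards [coeFn_indicatorCLM MeasurableSet.univ u] with x h1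
  rw [h1, Set.indicator_univ]

theorem indicatorCLM_empty (u : Lp 𝕜 1 μ) : indicatorCLM 𝕜 μ MeasurableSet.empty u = 0 := by
  rw [← norm_eq_zero, norm_indicatorCLM]; simp

theorem indicatorCLM_compl (hA : MeasurableSet A) (u : Lp 𝕜 1 μ) :
    indicatorCLM 𝕜 μ hA.compl u = u - indicatorCLM 𝕜 μ hA u := by
  rw [eq_sub_iff_add_eq', ← indicatorCLM_union hA hA.compl disjoint_compl_right,
    indicatorCLM_congr _ MeasurableSet.univ (Set.union_compl_self A), indicatorCLM_univ]

theorem norm_eq_norm_indicatorCLM_add (hA : MeasurableSet A) (u : Lp 𝕜 1 μ) :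
    ‖u‖ = ‖indicatorCLM 𝕜 μ hA u‖ + ‖u - indicatorCLM 𝕜 μ hA u‖ := by
  rw [← indicatorCLM_compl, norm_indicatorCLM, norm_indicatorCLM, L1.norm_eq_integral_norm,
    integral_add_compl hA (L1.integrable_coeFn u).norm]

theorem indicatorCLM_biUnion_finset {ι : Type*} (s : Finset ι) {A : ι → Set Ω}
    (hA : ∀ i, MeasurableSet (A i)) (hd : Pairwise (Function.onFun Disjoint A)) (u : Lp 𝕜 1 μ) :
    indicatorCLM 𝕜 μ (Finset.measurableSet_biUnion s fun i _ => hA i) u =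
      ∑ i ∈ s, indicatorCLM 𝕜 μ (hA i) u := by
  classical
  induction s using Finset.induction_on with
  | empty =>
    rw [indicatorCLM_congr _ MeasurableSet.empty (by simp), indicatorCLM_empty, Finset.sum_empty]
  | insert i s hi ih =>
    rw [Finset.sum_insert hi, ← ih, ← indicatorCLM_union]
    · exact indicatorCLM_congr _ _ (by simp) u
    · rw [Set.disjoint_iUnion₂_right]
      exact fun j hj => hd fun h => hi (h ▸ hj)

/-- The vector measure `E ↦ 𝟙_E u` with values in `L¹`. -/
noncomputable def indicatorVectorMeasure (u : Lp 𝕜 1 μ) : VectorMeasure Ω (Lp 𝕜 1 μ) := by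
  classical
  exact
  { measureOf' := fun E => if hE : MeasurableSet E then indicatorCLM 𝕜 μ hE u else 0
    empty' := by rw [dif_pos MeasurableSet.empty, indicatorCLM_empty]
    not_measurable' := fun E hE => dif_neg hE
    m_iUnion' := fun A hA hd => by
      have hU := MeasurableSet.iUnion hA
      simp only [dif_pos hU, dif_pos (hA _)]
      have hsum := hasSum_integral_iUnion hA hd (L1.integrable_coeFn u).norm.integrableOn
      rw [HasSum, tendsto_iff_norm_sub_tendsto_zero]
      rw [HasSum, tendsto_iff_norm_sub_tendsto_zero] at hsum
      refine hsum.congr fun s => ?_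
      have hs := Finset.measurableSet_biUnion s fun i _ => hA i
      have hsub : (⋃ i ∈ s, A i) ∩ (⋃ i, A i) = ⋃ i ∈ s, A i :=
        Set.inter_eq_left.2 (Set.iUnion₂_subset fun i _ => Set.subset_iUnion A i)
      -- By L-additivity the norm of the remainder equals the remainder of the scalar series of
      -- $\int_{A_i}\|u\|$, so countable additivity reduces to the real case.
      have key := norm_eq_norm_indicatorCLM_add hs (indicatorCLM 𝕜 μ hU u)
      rw [indicatorCLM_indicatorCLM, indicatorCLM_congr _ hs hsub, norm_indicatorCLM hU,
        norm_indicatorCLM hs, integral_biUnion_finset s (fun i _ => hA i)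
          (fun i _ j _ hij => hd hij)
          (fun i _ => (L1.integrable_coeFn u).norm.integrableOn)] at key
      rw [← indicatorCLM_biUnion_finset s hA hd, norm_sub_rev (indicatorCLM 𝕜 μ hs u),
        norm_sub_rev, key, add_sub_cancel_left, norm_norm] }

theorem indicatorVectorMeasure_apply (u : Lp 𝕜 1 μ) (hA : MeasurableSet A) :
    indicatorVectorMeasure u A = indicatorCLM 𝕜 μ hA u :=
  dif_pos hA

/-- A functional of norm at most one which almost norms `f` does so uniformly on all pieces of `f`
over a set which carries most of the mass of `f`. -/
theorem exists_measurableSet_forall_le_re (ℓ : Lp 𝕜 1 μ →L[𝕜] 𝕜) (hℓ : ‖ℓ‖ ≤ 1) (f : Lp 𝕜 1 μ)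
    (β : ℝ) :
    ∃ (A : Set Ω) (hA : MeasurableSet A), A ⊆ {x | f x ≠ 0} ∧
      (∀ E (hE : MeasurableSet E), E ⊆ A →
        (1 - β) * ‖indicatorCLM 𝕜 μ hE f‖ ≤ RCLike.re (ℓ (indicatorCLM 𝕜 μ hE f))) ∧
      β * ‖f - indicatorCLM 𝕜 μ hA f‖ ≤ ‖f‖ - RCLike.re (ℓ f) := by
  have hre : Continuous fun u => RCLike.re (ℓ u) := RCLike.continuous_re.comp ℓ.continuous
  let φ : Lp 𝕜 1 μ →+ ℝ := (RCLike.re : 𝕜 →+ ℝ).comp (ℓ : Lp 𝕜 1 μ →+ 𝕜)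
  -- A positive set of $\nu(E)=\mathrm{Re}\,\ell(\mathbb 1_Ef)-(1-\beta)\|\mathbb 1_Ef\|$ is one on
  -- which $\ell$ nearly norms every piece of $f$.
  let ν : SignedMeasure Ω := (indicatorVectorMeasure f).mapRange φ hre -
    (1 - β) • μ.withDensityᵥ fun x => ‖f x‖
  have hν : ∀ E (hE : MeasurableSet E), ν E =
      RCLike.re (ℓ (indicatorCLM 𝕜 μ hE f)) - (1 - β) * ‖indicatorCLM 𝕜 μ hE f‖ :=
    fun E hE => by
      rw [norm_indicatorCLM, ← withDensityᵥ_apply (L1.integrable_coeFn f).norm hE,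
        ← indicatorVectorMeasure_apply f hE]
      rfl
  obtain ⟨H, hH, hpos, hneg⟩ := ν.exists_compl_positive_negative
  have hf0 : MeasurableSet {x | f x ≠ 0} :=
    (Lp.stronglyMeasurable f).measurable (measurableSet_singleton 0).compl
  have hpos' := (VectorMeasure.restrict_le_restrict_iff _ _ hH).1 hpos
  have hneg' := (VectorMeasure.restrict_le_restrict_iff _ _ hH.compl).1 hneg
  have hHf : indicatorCLM 𝕜 μ (hH.inter hf0) f = indicatorCLM 𝕜 μ hH f := by
    refine Lp.ext ?_
    filter_upwards [coeFn_indicatorCLM (hH.inter hf0) f, coeFn_indicatorCLM hH f] with x h1 h2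
    classical
    rw [h1, h2, Set.indicator_apply, Set.indicator_apply]
    by_cases hx : x ∈ H <;> by_cases h0 : f x = 0 <;> simp [hx, h0]
  refine ⟨H ∩ {x | f x ≠ 0}, hH.inter hf0, Set.inter_subset_right, fun E hE hEA => ?_, ?_⟩
  · have := hpos' hE (hEA.trans Set.inter_subset_left)
    rw [hν E hE] at this
    simpa using this
  -- Off $H$ the functional loses at least the fraction $\beta$ of the mass, and on $H$ it cannot
  -- exceed the norm; adding the two gives the bound.
  · have h1 := hneg' hH.compl subset_rfl
    rw [hν _ hH.compl, indicatorCLM_compl hH, map_sub, map_sub] at h1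
    have h2 : RCLike.re (ℓ (indicatorCLM 𝕜 μ hH f)) ≤ ‖indicatorCLM 𝕜 μ hH f‖ :=
      (RCLike.re_le_norm _).trans ((ℓ.le_of_opNorm_le hℓ _).trans_eq (one_mul _))
    have h3 := norm_eq_norm_indicatorCLM_add hH f
    change β * ‖f - indicatorCLM 𝕜 μ (hH.inter hf0) f‖ ≤ _
    rw [hHf]
    simp only [FunLike.coe_zero, Pi.zero_apply] at h1
    linarith

/-- The $L_1$-norm is additive on disjoint supports, so the bound passes from single pieces
$c\,\mathbb 1_Ef$ to simple multiples of $f$. -/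
theorem norm_apply_toL1_simpleFunc_mul_le (D : Lp 𝕜 1 μ →L[𝕜] Y) (f : Lp 𝕜 1 μ) {ε : ℝ}
    (hA : MeasurableSet A)
    (hD : ∀ E (hE : MeasurableSet E), E ⊆ A →
      ‖D (indicatorCLM 𝕜 μ hE f)‖ ≤ ε * ‖indicatorCLM 𝕜 μ hE f‖)
    (φ : SimpleFunc Ω 𝕜) :
    ∀ h : Integrable (fun x => φ x * A.indicator f x) μ, ‖D (h.toL1 _)‖ ≤ ε * ‖h.toL1 _‖ := by
  have hint : ∀ φ : SimpleFunc Ω 𝕜, Integrable (fun x => φ x * A.indicator f x) μ := fun φ => by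
    obtain ⟨C, hC⟩ := φ.exists_forall_norm_le
    exact ((L1.integrable_coeFn f).indicator hA).bdd_mul φ.aestronglyMeasurable
      (Eventually.of_forall hC)
  induction φ using SimpleFunc.induction with
  | @const c s hs =>
    intro h
    have : h.toL1 _ = c • indicatorCLM 𝕜 μ (hs.inter hA) f := by
      refine Lp.ext ?_
      filter_upwards [h.coeFn_toL1, coeFn_indicatorCLM (hs.inter hA) f,
        Lp.coeFn_smul c (indicatorCLM 𝕜 μ (hs.inter hA) f)] with x h1 h2 h3
      rw [h1, h3, Pi.smul_apply, h2]
      by_cases hx : x ∈ s <;> by_cases hx' : x ∈ A <;> simp [hx, hx']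
    rw [this, map_smul, norm_smul, norm_smul, mul_left_comm]
    exact mul_le_mul_of_nonneg_left (hD _ _ Set.inter_subset_right) (norm_nonneg c)
  | @add φ ψ hd hφ hψ =>
    intro h
    have hadd : h.toL1 _ = (hint φ).toL1 _ + (hint ψ).toL1 _ := by
      rw [← Integrable.toL1_add, Integrable.toL1_eq_toL1_iff]
      exact Eventually.of_forall fun x => by simp [add_mul]
    have hn : ‖h.toL1 _‖ = ‖(hint φ).toL1 _‖ + ‖(hint ψ).toL1 _‖ := by
      rw [L1.norm_of_fun_eq_integral_norm, L1.norm_of_fun_eq_integral_norm,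
        L1.norm_of_fun_eq_integral_norm, ← MeasureTheory.integral_add (hint φ).norm (hint ψ).norm]
      refine integral_congr_ae (Eventually.of_forall fun x => ?_)
      by_cases hx : φ x = 0
      · simp [hx]
      · have : ψ x = 0 := by
          by_contra h0
          exact Set.disjoint_left.1 hd hx h0
        simp [this]
    rw [hn, hadd, map_add, mul_add]
    exact (norm_add_le _ _).trans (add_le_add (hφ _) (hψ _))

/-- An operator on `L¹` which is small on all pieces of `f` over subsets of `A` is small on all
integrable functions supported in `A`, provided that `f` does not vanish on `A`. -/
theorem norm_apply_indicatorCLM_le (D : Lp 𝕜 1 μ →L[𝕜] Y) (f : Lp 𝕜 1 μ) {ε : ℝ}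
    (hA : MeasurableSet A) (hAf : A ⊆ {x | f x ≠ 0})
    (hD : ∀ E (hE : MeasurableSet E), E ⊆ A →
      ‖D (indicatorCLM 𝕜 μ hE f)‖ ≤ ε * ‖indicatorCLM 𝕜 μ hE f‖) (u : Lp 𝕜 1 μ) :
    ‖D (indicatorCLM 𝕜 μ hA u)‖ ≤ ε * ‖indicatorCLM 𝕜 μ hA u‖ := by
  have hfm : Measurable f := (Lp.stronglyMeasurable f).measurable
  have hum : Measurable u := (Lp.stronglyMeasurable u).measurable
  -- On $A$ one has $u=gf$. Approximating $g$ by simple $\varphi_n$ with $|\varphi_n|\le2|g|$ gives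
  -- domination by $3|u|$ on $A$, although $g$ itself may fail to be integrable.
  let g : Ω → 𝕜 := fun x => (f x)⁻¹ * A.indicator u x
  have hg : Measurable g := hfm.inv.mul (hum.indicator hA)
  have hgf : ∀ x, g x * A.indicator f x = A.indicator u x := fun x => by
    by_cases hx : x ∈ A
    · have : f x ≠ 0 := hAf hx
      simp only [g, Set.indicator_of_mem hx]
      field_simp
    · simp [hx]
  let φ : ℕ → SimpleFunc Ω 𝕜 := SimpleFunc.approxOn g hg Set.univ 0 (Set.mem_univ 0)
  have hφg : ∀ n x, ‖φ n x‖ ≤ ‖g x‖ + ‖g x‖ := fun n x =>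
    SimpleFunc.norm_approxOn_zero_le hg (Set.mem_univ 0) x n
  have hφlim : ∀ x, Tendsto (fun n => φ n x) atTop (𝓝 (g x)) := fun x =>
    SimpleFunc.tendsto_approxOn hg (Set.mem_univ 0) (by simp)
  have hint : ∀ n, Integrable (fun x => φ n x * A.indicator f x) μ := fun n => by
    obtain ⟨C, hC⟩ := (φ n).exists_forall_norm_le
    exact ((L1.integrable_coeFn f).indicator hA).bdd_mul (φ n).aestronglyMeasurable
      (Eventually.of_forall hC)
  have huA : Integrable (A.indicator u) μ := (L1.integrable_coeFn u).indicator hA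
  have hu : indicatorCLM 𝕜 μ hA u = huA.toL1 _ := by
    refine Lp.ext ?_
    filter_upwards [huA.coeFn_toL1, coeFn_indicatorCLM hA u] with x h1 h2
    rw [h1, h2]
  have hlim : Tendsto (fun n => (hint n).toL1 _) atTop (𝓝 (indicatorCLM 𝕜 μ hA u)) := by
    rw [tendsto_iff_norm_sub_tendsto_zero, hu]
    have : ∀ n, ‖(hint n).toL1 _ - huA.toL1 _‖ =
        ∫ x, ‖φ n x * A.indicator f x - A.indicator u x‖ ∂μ := fun n => by
      rw [← Integrable.toL1_sub, L1.norm_of_fun_eq_integral_norm]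
      rfl
    simp_rw [this]
    have h0 : ∫ _, (0 : ℝ) ∂μ = 0 := by simp
    rw [← h0]
    refine tendsto_integral_of_dominated_convergence
      (F := fun n x => ‖φ n x * A.indicator f x - A.indicator u x‖) (fun x => 3 * ‖A.indicator u x‖)
      (fun n => ((hint n).sub huA).norm.aestronglyMeasurable) (huA.norm.const_mul 3)
      (fun n => Eventually.of_forall fun x => ?_) (Eventually.of_forall fun x => ?_)
    · rw [norm_norm]
      refine (norm_sub_le _ _).trans ?_
      have h1 : ‖φ n x * A.indicator f x‖ ≤ 2 * ‖A.indicator u x‖ := by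
        rw [← hgf x, norm_mul, norm_mul, ← mul_assoc]
        exact mul_le_mul_of_nonneg_right (by linarith [hφg n x]) (norm_nonneg _)
      linarith
    · have := (((hφlim x).mul_const (A.indicator f x)).sub_const (A.indicator u x)).norm
      rwa [hgf, sub_self, norm_zero] at this
  exact le_of_tendsto_of_tendsto' ((D.continuous.tendsto _).comp hlim).norm
    (hlim.norm.const_mul ε)
    fun n => norm_apply_toL1_simpleFunc_mul_le D f hA hD (φ n) (hint n)

/-- Integration against the conjugate of the sign of `f` over a measurable set. -/
theorem exists_functional_eq_norm (f : Lp 𝕜 1 μ) (hA : MeasurableSet A) :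
    ∃ Λ : Lp 𝕜 1 μ →L[𝕜] 𝕜, (∀ u, ‖Λ u‖ ≤ ‖indicatorCLM 𝕜 μ hA u‖) ∧
      ∀ E (hE : MeasurableSet E), E ⊆ A →
        Λ (indicatorCLM 𝕜 μ hE f) = (‖indicatorCLM 𝕜 μ hE f‖ : 𝕜) := by
  have hfm : Measurable f := (Lp.stronglyMeasurable f).measurable
  -- At zeros of $f$ the quotient is $0/0=0$, which is harmless.
  let g : Ω → 𝕜 := fun x => A.indicator (fun x => (starRingEnd 𝕜) (f x) / (‖f x‖ : 𝕜)) x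
  have hg : Measurable g := by
    refine Measurable.indicator (Measurable.div ?_ ?_) hA
    · exact RCLike.continuous_conj.measurable.comp hfm
    · exact RCLike.continuous_ofReal.measurable.comp hfm.norm
  have hb' : ∀ x, ‖g x‖ ≤ A.indicator 1 x := fun x => by
    by_cases hx : x ∈ A
    · simp only [g, Set.indicator_of_mem hx, norm_div, RCLike.norm_conj, RCLike.norm_ofReal,
        abs_norm, Pi.one_apply]
      exact div_self_le_one _
    · simp [g, hx]
  have hb : ∀ x, ‖g x‖ ≤ 1 := fun x =>
    (hb' x).trans (Set.indicator_le_self' (fun _ _ => zero_le_one) x)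
  refine ⟨L1.integralCLM' (α := Ω) (E := 𝕜) (μ := μ) 𝕜 ∘L mulCLM μ g hg hb, fun u => ?_, fun E hE hEA => ?_⟩
  · have h1 : L1.integralCLM' (α := Ω) (E := 𝕜) (μ := μ) 𝕜 (mulCLM μ g hg hb u) = ∫ x, mulCLM μ g hg hb u x ∂μ := by
      exact (L1.integral_eq' 𝕜 _).symm.trans (L1.integral_eq_integral _)
    rw [ContinuousLinearMap.comp_apply, h1]
    refine (norm_integral_le_integral_norm _).trans ?_
    rw [L1.norm_eq_integral_norm]
    refine integral_mono_ae (L1.integrable_coeFn _).norm (L1.integrable_coeFn _).norm ?_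
    filter_upwards [coeFn_mulCLM hg hb u, coeFn_indicatorCLM hA u] with x h2 h3
    rw [h2, h3, norm_mul]
    have := hb' x
    by_cases hx : x ∈ A
    · simp only [Set.indicator_of_mem hx, Pi.one_apply] at this ⊢
      exact mul_le_of_le_one_left (norm_nonneg _) this
    · simp only [Set.indicator_of_notMem hx] at this ⊢
      simp [norm_le_zero_iff.1 this]
  · have h1 : L1.integralCLM' (α := Ω) (E := 𝕜) (μ := μ) 𝕜 (mulCLM μ g hg hb (indicatorCLM 𝕜 μ hE f)) =
        ∫ x, mulCLM μ g hg hb (indicatorCLM 𝕜 μ hE f) x ∂μ := by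
      exact (L1.integral_eq' 𝕜 _).symm.trans (L1.integral_eq_integral _)
    rw [ContinuousLinearMap.comp_apply, h1, L1.norm_eq_integral_norm, ← integral_ofReal]
    refine integral_congr_ae ?_
    filter_upwards [coeFn_mulCLM hg hb (indicatorCLM 𝕜 μ hE f), coeFn_indicatorCLM hE f]
      with x h2 h3
    rw [h2, h3]
    by_cases hx : x ∈ E
    · simp only [g, Set.indicator_of_mem hx, Set.indicator_of_mem (hEA hx)]
      rw [div_mul_eq_mul_div, RCLike.conj_mul, sq, mul_self_div_self]
    · simp [hx]

end MeasureTheory.L1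

open MeasureTheory.L1

/-- If `Y` is uniformly convex, then `(L¹(μ), Y)` has the BPBp-RSE. -/
theorem HasBPBpRSE.of_uniformConvexSpace (μ : Measure Ω) [UniformConvexSpace Y] :
    HasBPBpRSE 𝕜 (Lp 𝕜 1 μ) Y := by
  intro ε hε
  let _ : NormedSpace ℝ Y := NormedSpace.restrictScalars ℝ 𝕜 Y
  set r : ℝ := min (ε / 4) (1 / 2)
  have hr0 : 0 < r := by positivity
  have hr1 : r ≤ ε / 4 := min_le_left _ _
  have hr2 : r ≤ 1 / 2 := min_le_right _ _
  obtain ⟨δ, hδ, huc⟩ := exists_forall_closed_ball_dist_add_le_two_sub Y hr0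
  -- A point $z\in B_Y$ of the slice has $\|z+y_0\|\ge2-\beta>2-\delta$, hence lies within $r$ of
  -- $y_0$.
  set β : ℝ := min (δ / 2) 1
  have hβ0 : 0 < β := by positivity
  have hβ1 : β ≤ δ / 2 := min_le_left _ _
  have hβ2 : β ≤ 1 := min_le_right _ _
  -- With this $\eta$ the mass estimate reads $\beta\|f-Pf\|\le1-\|Tf\|<\beta r$.
  refine ⟨min (β * r) (ε / 2), by positivity, (min_le_right _ _).trans_lt (by linarith),
    fun T f hT hf hTf => ?_⟩
  have hTle : ∀ u, ‖T u‖ ≤ ‖u‖ := fun u => by simpa [hT] using T.le_opNorm u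
  have hη := min_le_left (β * r) (ε / 2)
  have hTf0 : 0 < ‖T f‖ := by nlinarith
  obtain ⟨ψ, hψ, hψT⟩ := exists_dual_vector 𝕜 (T f) hTf0.ne'
  set y₀ : Y := (‖T f‖ : 𝕜)⁻¹ • T f with hy₀
  have hy₀n : ‖y₀‖ = 1 := by simp [hy₀, norm_smul, hTf0.ne']
  have hψy₀ : ψ y₀ = 1 := by
    rw [hy₀, map_smul, hψT, smul_eq_mul, inv_mul_cancel₀]
    exact_mod_cast hTf0.ne'
  have hψle : ∀ y, ‖ψ y‖ ≤ ‖y‖ := fun y => by simpa [hψ] using ψ.le_opNorm y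
  have hslice : ∀ z : Y, ‖z‖ ≤ 1 → 1 - β ≤ RCLike.re (ψ z) → ‖z - y₀‖ ≤ r := fun z hz hz' => by
    by_contra! hlt
    have h1 := huc hz hy₀n.le hlt.le
    have h2 : RCLike.re (ψ (z + y₀)) ≤ ‖z + y₀‖ := (RCLike.re_le_norm _).trans (hψle _)
    rw [map_add, map_add, hψy₀, RCLike.one_re] at h2
    linarith
  have hℓ : ‖ψ ∘L T‖ ≤ 1 := by
    refine (ψ.opNorm_comp_le T).trans ?_
    rw [hψ, hT, one_mul]
  obtain ⟨A, hA, hAf, hre, hmass⟩ := exists_measurableSet_forall_le_re (ψ ∘L T) hℓ f β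
  obtain ⟨Λ, hΛ, hΛf⟩ := exists_functional_eq_norm f hA
  set P := indicatorCLM 𝕜 μ hA with hP
  have hPn : ∀ u, ‖u‖ = ‖P u‖ + ‖u - P u‖ := norm_eq_norm_indicatorCLM_add hA
  have hPP : ∀ u, P (P u) = P u := fun u => by
    rw [hP, indicatorCLM_indicatorCLM, indicatorCLM_congr _ hA (Set.inter_self A)]
  have hΛP : ∀ u, Λ (P u) = Λ u := fun u => by
    have := hΛ (u - P u)
    rw [map_sub P, hPP, sub_self, norm_zero, norm_le_zero_iff, map_sub, sub_eq_zero] at this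
    exact this.symm
  have hfar : ‖f - P f‖ < r := by
    rw [ContinuousLinearMap.comp_apply, hψT, RCLike.ofReal_re, hf] at hmass
    by_contra! hlt
    have := mul_le_mul_of_nonneg_left hlt hβ0.le
    linarith
  have hPf := hPn f
  rw [hf] at hPf
  have hPf0 : 0 < ‖P f‖ := by linarith
  have hD : ∀ u, ‖T (P u) - Λ u • y₀‖ ≤ r * ‖P u‖ := fun u => by
    have key := norm_apply_indicatorCLM_le (T - Λ.smulRight y₀) f (ε := r) hA hAf
      (fun E hE hEA => ?_) u
    · simpa [← hP, hΛP] using key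
    · set v := indicatorCLM 𝕜 μ hE f with hv
      rcases eq_or_ne v 0 with h0 | h0
      · simp [h0]
      · have hv0 : 0 < ‖v‖ := norm_pos_iff.2 h0
        have hv0' : (‖v‖ : 𝕜) ≠ 0 := by exact_mod_cast hv0.ne'
        have h1 := hslice ((‖v‖ : 𝕜)⁻¹ • T v) (by
          rw [norm_smul, norm_inv, RCLike.norm_ofReal, abs_norm, inv_mul_le_iff₀ hv0, mul_one]
          exact hTle v) (by
          rw [map_smul, smul_eq_mul, ← RCLike.ofReal_inv, RCLike.re_ofReal_mul,
            le_inv_mul_iff₀ hv0, mul_comm]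
          exact hre E hE hEA)
        have h2 : (T - Λ.smulRight y₀) v = (‖v‖ : 𝕜) • ((‖v‖ : 𝕜)⁻¹ • T v - y₀) := by
          rw [smul_sub, smul_smul, mul_inv_cancel₀ hv0', one_smul, ← hΛf E hE hEA]
          rfl
        rw [h2, norm_smul, RCLike.norm_ofReal, abs_norm, mul_comm]
        exact mul_le_mul_of_nonneg_right h1 hv0.le
  -- Shrinking $T$ off $A$ by $1-r$ costs at most $r$ in norm and creates the gap that yields range
  -- strong exposure.
  let R : Lp 𝕜 1 μ →L[𝕜] Y := ((1 - r : ℝ) : 𝕜) • (T ∘L (ContinuousLinearMap.id 𝕜 _ - P))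
  have hR : ∀ u, R u = ((1 - r : ℝ) : 𝕜) • T (u - P u) := fun u => rfl
  set x₀ : Lp 𝕜 1 μ := (‖P f‖ : 𝕜)⁻¹ • P f with hx₀
  have hx₀n : ‖x₀‖ = 1 := by simp [hx₀, norm_smul, hPf0.ne']
  have hΛx₀ : Λ x₀ = 1 := by
    rw [hx₀, map_smul, hΛf A hA subset_rfl, smul_eq_mul, inv_mul_cancel₀]
    exact_mod_cast hPf0.ne'
  obtain ⟨hS, hSn, hSx₀⟩ := IsRangeStronglyExposing.of_smulRight_add (Λ := Λ) (R := R)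
    (q := fun u => ‖u - P u‖) hr0 hy₀n hx₀n hΛx₀ (fun _ => norm_nonneg _)
    (fun u => by
      rw [hPn u]
      exact add_le_add_left (hΛ u) _)
    (fun u => by
      rw [hR, norm_smul, RCLike.norm_ofReal, abs_of_nonneg (by linarith)]
      exact mul_le_mul_of_nonneg_left (hTle _) (by linarith))
  refine ⟨_, x₀, hS, hx₀n, hSn, by rw [hSx₀, hy₀n], ?_, ?_⟩
  · refine lt_of_le_of_lt (ContinuousLinearMap.opNorm_le_bound _ hr0.le fun u => ?_)
      (by linarith : r < ε)
    have h1 : (Λ.smulRight y₀ + R - T) u =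
        -((T (P u) - Λ u • y₀) + (r : 𝕜) • T (u - P u)) := by
      simp only [sub_apply, add_apply, hR,
        ContinuousLinearMap.smulRight_apply, map_sub, RCLike.ofReal_one, sub_smul, one_smul, smul_sub]
      abel
    rw [h1, norm_neg, hPn u, mul_add]
    refine (norm_add_le _ _).trans (add_le_add (hD u) ?_)
    rw [norm_smul, RCLike.norm_ofReal, abs_of_pos hr0]
    exact mul_le_mul_of_nonneg_left (hTle _) hr0.le
  -- Normalizing $Pf$ moves it by $1-\|Pf\|$, exactly the mass lost off $A$; in total
  -- $\|f-x_0\|<2r<\varepsilon$.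
  · have h1 : ‖P f - x₀‖ = ‖f - P f‖ := by
      have : P f - x₀ = ((‖P f‖ - 1 : ℝ) : 𝕜) • x₀ := by
        have : (‖P f‖ : 𝕜) ≠ 0 := by exact_mod_cast hPf0.ne'
        rw [RCLike.ofReal_sub, sub_smul, RCLike.ofReal_one, one_smul, hx₀, smul_smul,
          mul_inv_cancel₀ this, one_smul]
      rw [this, norm_smul, hx₀n, mul_one, RCLike.norm_ofReal, abs_of_nonpos (by
        linarith [norm_nonneg (f - P f)])]
      linarith
    calc ‖f - x₀‖ ≤ ‖f - P f‖ + ‖P f - x₀‖ := norm_sub_le_norm_sub_add_norm_sub _ _ _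
      _ < ε := by linarith

end LOne

/-! ### Nontrivial L-projections of $L_1(\mu)$ from sets of positive measure. -/

section Necessity

open MeasureTheory.L1

variable {𝕜 Ω Y : Type*} [RCLike 𝕜] [MeasurableSpace Ω] {μ : Measure Ω}
  [NormedAddCommGroup Y] [NormedSpace 𝕜 Y]

/-- $\sigma$-finiteness gives a subset of finite positive measure, whose indicator is integrable. -/
theorem MeasureTheory.L1.exists_ne_zero_indicatorCLM_eq_self [SigmaFinite μ] {A B : Set Ω}
    (hA : MeasurableSet A) (hB : MeasurableSet B) (h : μ (A ∩ B) ≠ 0) :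
    ∃ u : Lp 𝕜 1 μ, u ≠ 0 ∧ indicatorCLM 𝕜 μ hB u = u := by
  obtain ⟨C, hC, hCAB, hC0, hCtop⟩ :=
    Measure.exists_subset_measure_lt_top (hA.inter hB) (pos_iff_ne_zero.2 h)
  refine ⟨indicatorConstLp 1 hC hCtop.ne 1, ?_, ?_⟩
  · rw [← norm_ne_zero_iff, norm_indicatorConstLp one_ne_zero ENNReal.one_ne_top]
    simp [Measure.real, ENNReal.toReal_eq_zero_iff, hC0.ne', hCtop.ne]
  · refine Lp.ext ?_
    have hc := indicatorConstLp_coeFn (p := 1) (hs := hC) (hμs := hCtop.ne) (c := (1 : 𝕜))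
    filter_upwards [coeFn_indicatorCLM hB (indicatorConstLp 1 hC hCtop.ne (1 : 𝕜)), hc]
      with x h1 h2
    rw [h1]
    by_cases hx : x ∈ B
    · rw [Set.indicator_of_mem hx]
    · rw [Set.indicator_of_notMem hx, h2,
        Set.indicator_of_notMem fun hxC => hx (hCAB hxC).2]

/-- If `Ω` splits into two measurable sets of positive measure and `(L¹(μ), Y)` has the BPBp-RSE,
then `Y` is uniformly convex. -/
theorem HasBPBpRSE.uniformConvexSpace_of_measure_ne_zero [SigmaFinite μ] {A : Set Ω}
    (hA : MeasurableSet A) (h1 : μ A ≠ 0) (h2 : μ Aᶜ ≠ 0) (h : HasBPBpRSE 𝕜 (Lp 𝕜 1 μ) Y) :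
    UniformConvexSpace Y := by
  obtain ⟨u, hu, hu'⟩ := exists_ne_zero_indicatorCLM_eq_self (𝕜 := 𝕜) (μ := μ) hA hA (by simpa)
  obtain ⟨v, hv, hv'⟩ := exists_ne_zero_indicatorCLM_eq_self (𝕜 := 𝕜) (μ := μ) hA.compl hA.compl
    (by simpa)
  refine h.uniformConvexSpace (indicatorCLM 𝕜 μ hA) (norm_eq_norm_indicatorCLM_add hA) hu hv hu' ?_
  rw [indicatorCLM_compl hA, sub_eq_self] at hv'
  exact hv'

/-- If every measurable set were null or conull, the preimages under an integrable function would be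
too; such a function is a.e. constant, leaving dimension at most one. -/
theorem MeasureTheory.exists_measurableSet_ne_zero_of_two_le_rank
    (h : 2 ≤ Module.rank 𝕜 (Lp 𝕜 1 μ)) :
    ∃ A : Set Ω, MeasurableSet A ∧ μ A ≠ 0 ∧ μ Aᶜ ≠ 0 := by
  by_contra! H
  have hconst : ∀ u : Lp 𝕜 1 μ, ∃ c : 𝕜, u =ᵐ[μ] Function.const Ω c := fun u => by
    refine exists_eventuallyEq_const_of_forall_separating MeasurableSet fun U hU => ?_
    have hm : MeasurableSet (u ⁻¹' U) := (Lp.stronglyMeasurable u).measurable hU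
    rcases eq_or_ne (μ (u ⁻¹' U)) 0 with h0 | h0
    · exact Or.inr (measure_eq_zero_iff_ae_notMem.1 h0)
    · exact Or.inl (H _ hm h0)
  have hle : Module.rank 𝕜 (Lp 𝕜 1 μ) ≤ 1 := by
    rw [rank_le_one_iff]
    by_cases hz : ∃ u : Lp 𝕜 1 μ, u ≠ 0
    · obtain ⟨u, hu⟩ := hz
      refine ⟨u, fun v => ?_⟩
      obtain ⟨c, hc⟩ := hconst u
      obtain ⟨d, hd⟩ := hconst v
      have hc0 : c ≠ 0 := by
        rintro rfl
        exact hu ((Lp.eq_zero_iff_ae_eq_zero).2 hc)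
      refine ⟨d / c, Lp.ext ?_⟩
      filter_upwards [hc, hd, Lp.coeFn_smul (d / c) u] with x h1 h2 h3
      rw [h3, Pi.smul_apply, h1, h2, Function.const_apply, Function.const_apply, smul_eq_mul,
        div_mul_cancel₀ _ hc0]
    · push Not at hz
      exact ⟨0, fun v => ⟨0, by rw [hz v, smul_zero]⟩⟩
  exact absurd (h.trans hle) (by norm_num)

end Necessity

/-! ### The sequence spaces as $L_1$ of a counting measure. -/

section Counting

variable {𝕜 ι Y : Type*} [RCLike 𝕜] [MeasurableSpace ι] [MeasurableSingletonClass ι]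
  [NormedAddCommGroup Y] [NormedSpace 𝕜 Y]

theorem lp.integrable_count (x : lp (fun _ : ι => 𝕜) 1) :
    Integrable (fun i => x i) (Measure.count : Measure ι) := by
  rw [integrable_count_iff]
  simpa using (lp.memℓp x).summable (by simp)

/-- The space `ℓ¹` is the `L¹` space of the counting measure. -/
noncomputable def lpEquivLpCount (𝕜 ι : Type*) [RCLike 𝕜] [Countable ι] [MeasurableSpace ι]
    [MeasurableSingletonClass ι] :
    lp (fun _ : ι => 𝕜) 1 ≃ₗᵢ[𝕜] Lp 𝕜 1 (Measure.count : Measure ι) :=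
  LinearIsometryEquiv.ofSurjective
    { toFun := fun x => (lp.integrable_count x).toL1 _
      map_add' := fun x y => rfl
      map_smul' := fun c x => rfl
      norm_map' := fun x => by
        change ‖(lp.integrable_count x).toL1 _‖ = ‖x‖
        rw [L1.norm_of_fun_eq_integral_norm, integral_countable (lp.integrable_count x).norm,
          lp.norm_eq_tsum_rpow (by simp)]
        simp [Measure.real] }
    fun u => by
      have hu := integrable_count_iff.1 (L1.integrable_coeFn u)
      refine ⟨⟨fun i => u i, memℓp_gen (by simpa using hu)⟩, ?_⟩
      exact Integrable.toL1_coeFn u (L1.integrable_coeFn u)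

theorem hasBPBpRSE_lp_iff [Countable ι] [Nontrivial ι] :
    HasBPBpRSE 𝕜 (lp (fun _ : ι => 𝕜) 1) Y ↔ UniformConvexSpace Y := by
  refine ⟨fun h => ?_, fun _ => ?_⟩
  · obtain ⟨i, j, hij⟩ := exists_pair_ne ι
    refine (h.of_linearIsometryEquiv (lpEquivLpCount 𝕜 ι)).uniformConvexSpace_of_measure_ne_zero
      (measurableSet_singleton i) ?_ ?_
    · simp
    · rw [Measure.count_ne_zero_iff]
      exact ⟨j, hij.symm⟩
  · exact (HasBPBpRSE.of_uniformConvexSpace Measure.count).of_linearIsometryEquiv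
      (lpEquivLpCount 𝕜 ι).symm

end Counting

theorem mainTheorem1 {𝕜 : Type*} [RCLike 𝕜]
    {Y : Type*} [NormedAddCommGroup Y] [NormedSpace 𝕜 Y] [CompleteSpace Y]
    {Ω : Type*} [MeasurableSpace Ω] (μ : Measure Ω) [SigmaFinite μ]
    (hμ : 2 ≤ Module.rank 𝕜 (Lp 𝕜 1 μ))
    (m : ℕ) (hm : 2 ≤ m) :
    List.TFAE [
      HasBPBpRSE 𝕜 (PiLp 1 (fun _ : Fin m => 𝕜)) Y,
      HasBPBpRSE 𝕜 (lp (fun _ : ℕ => 𝕜) 1) Y,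
      HasBPBpRSE 𝕜 (Lp 𝕜 1 μ) Y,
      UniformConvexSpace Y] := by
  have : Nontrivial (Fin m) := Fin.nontrivial_iff_two_le.2 hm
  tfae_have 1 ↔ 4 :=
    ⟨fun h => hasBPBpRSE_lp_iff.1
        (h.of_linearIsometryEquiv (lpPiLpₗᵢ (fun _ : Fin m => 𝕜) 𝕜).symm),
      -- The space $\ell_1^m$ is $\ell_1$ over the index set `Fin m`, so the same countable-index
      -- equivalence serves it and $\ell_1$.
      fun h => (hasBPBpRSE_lp_iff.2 h).of_linearIsometryEquiv (lpPiLpₗᵢ (fun _ : Fin m => 𝕜) 𝕜)⟩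
  tfae_have 2 ↔ 4 := hasBPBpRSE_lp_iff
  tfae_have 3 ↔ 4 := by
    refine ⟨fun h => ?_, fun _ => HasBPBpRSE.of_uniformConvexSpace μ⟩
    obtain ⟨A, hA, h1, h2⟩ := exists_measurableSet_ne_zero_of_two_le_rank hμ
    exact h.uniformConvexSpace_of_measure_ne_zero hA h1 h2
  tfae_finish
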